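/- Consider systems $\mathbf x_{t+1}=\mathbf A\mathbf x_t+\mathbf B\mathbf u_t+\mathbf w_t$ with $\mathbf x_0=\mathbf 0$, $\mathbf x_t\in\mathbb R^n$, $\mathbf u_t\in\mathbb R^p$, and i.i.d. noise $\mathbf w_t\sim\mathcal N(\mathbf 0,\sigma_w^2\mathbf I_n)$, $\sigma_w>0$, where $\mathbf w_t$ is independent of $(\mathbf u_{0:t},\mathbf x_{0:t})$; such a system is identified with the pair $(\mathbf A,\mathbf B)$. A learning-to-stabilize algorithm $\pi$ with $N\ge 0$ samples consists of, for each $0\le t\le N-1$, a conditional probability distribution $\pi_t(\mathbf u_{0:t-1},\mathbf x_{0:t})$ of the input $\mathbf u_t$ given the past $(\mathbf u_{0:t-1},\mathbf x_{0:t})$ (a Markov kernel), and a measurable map $\pi_N$ that sends the trajectory $(\mathbf u_{0:N-1},\mathbf x_{0:N})$ to a gain in $\mathbb R^{p\times n}$. Let $\mathbb P^N_{\mathcal S,\pi}$ be the resulting law of the trajectory when $\pi$ is run on the system $\mathcal S$, with expectation $\mathbb E^N_{\mathcal S,\pi}$, and let $\rho$ denote the spectral radius. Let $n\ge 2$, $r>1$,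 $0<v<\frac{r-1}{2}$, $p=1$, and for $b\ge 0$ let $$\mathbf A=\begin{bmatrix} r&v&0&\cdots&0\\ 0&0&v&\cdots&0\\ &&\ddots&\ddots&\\ 0&0&0&\cdots&v\\ 0&0&0&\cdots&0\end{bmatrix}\in\mathbb R^{n\times n},\qquad \mathbf B(b)=\begin{bmatrix} b\\0\\ \vdots\\0\\ v\end{bmatrix}\in\mathbb R^{n}.$$ Let $\mathcal S_1=(\mathbf A,\mathbf B(0))$ and $\mathcal S_2=(\mathbf A,\mathbf B(m))$ with $m=2\left(\frac{2v}{r-1}\right)^n$. Let $(\mathcal C_k)_{k\ge 1}$ be classes of single-input systems, $\mathcal C_k$ in state dimension $k$, such that for some constant $M>0$ one has $\|\mathbf A'\|_2\le M$ and $\|\mathbf B'\|_2\le M$ for all $k\ge 1$ and all $(\mathbf A',\mathbf B')\in\mathcal C_k$, and such that $\mathcal S_1,\mathcal S_2\in\mathcal C_n$. Let $\sigma_u>0$, and let $\pi$ be any learning-to-stabilize algorithm with $N$ samples such that $\mathbb E^N_{\mathcal S,\pi}\left[\|\mathbf u_t\|_2^2\right]\le\sigma_u^2$ for all $\mathcal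 S\in\mathcal C_n$ and $0\le t\le N-1$. Then, for every $0<\delta<1/2$, the requirement $$\inf_{\mathcal S=(\mathbf A',\mathbf B')\in\mathcal C_n}\mathbb P^N_{\mathcal S,\pi}\Big(\rho\big(\mathbf A'+\mathbf B'\,\pi_N(\mathbf u_{0:N-1},\mathbf x_{0:N})\big)<1\Big)\ \ge\ 1-\delta$$ is satisfied only if $$N\ \ge\ \frac{\sigma_w^2}{2\sigma_u^2}\left(\frac{r-1}{2v}\right)^{2n}\log\frac{1}{3\delta}.$$ -/

import Mathlib

open MeasureTheory ProbabilityTheory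
open scoped ENNReal

/-- A linear time-invariant system `x_{t+1} = A x_t + B u_t + w_t` with `n` states and `p` inputs,
identified with the pair `(A, B)`. -/
structure LTISystem (n p : ℕ) where
  A : Matrix (Fin n) (Fin n) ℝ
  B : Matrix (Fin n) (Fin p) ℝ

/-- The state-input trajectories `(u_{0:t-1}, x_{0:t})`. -/
abbrev Trajectory (n p t : ℕ) : Type :=
  (Fin t → (Fin p → ℝ)) × (Fin (t + 1) → (Fin n → ℝ))

/-- A learning-to-stabilize algorithm with `N` samples. For `t < N`, `explore t` is the conditional
distribution of `u_t` given `(u_{0:t-1}, x_{0:t})`; `gain` maps the whole trajectory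
`(u_{0:N-1}, x_{0:N})` to the learned state-feedback gain. -/
structure StabilizationAlgorithm (n p N : ℕ) where
  explore : (t : Fin N) → Kernel (Trajectory n p t) (Fin p → ℝ)
  isMarkovKernel_explore : ∀ t, IsMarkovKernel (explore t)
  gain : Trajectory n p N → Matrix (Fin p) (Fin n) ℝ
  measurable_gain : ∀ i j, Measurable fun h => gain h i j

/-- The Gaussian law `N(0, σ² Iₙ)` on `ℝⁿ`. -/
noncomputable def noiseLaw (n : ℕ) (σ : ℝ) : Measure (Fin n → ℝ) :=
  Measure.pi fun _ => gaussianReal 0 (σ ^ 2).toNNReal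

/-- One step of the dynamics: append the input `u` and the next state `A x_t + B u + w`
to a trajectory. -/
def LTISystem.step {n p : ℕ} (S : LTISystem n p) (t : ℕ)
    (q : (Trajectory n p t × (Fin p → ℝ)) × (Fin n → ℝ)) : Trajectory n p (t + 1) :=
  (Fin.snoc q.1.1.1 q.1.2,
    Fin.snoc q.1.1.2 (S.A.mulVec (q.1.1.2 (Fin.last t)) + S.B.mulVec q.1.2 + q.2))

/-- The law of `(u_{0:t-1}, x_{0:t})` when the algorithm `π` is run on `S` from `x_0 = 0`: the input
`u_t` is drawn from `π.explore t` given the past, and the noise `w_t ~ N(0, σw² Iₙ)` is independent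
of the past and of `u_t`. -/
noncomputable def lawUpTo {n p N : ℕ} (σw : ℝ) (S : LTISystem n p)
    (π : StabilizationAlgorithm n p N) : (t : ℕ) → t ≤ N → Measure (Trajectory n p t)
  | 0, _ => Measure.dirac (fun i => i.elim0, fun _ => 0)
  | t + 1, ht =>
    (((lawUpTo σw S π t (Nat.le_of_succ_le ht)) ⊗ₘ (π.explore ⟨t, ht⟩)).prod
      (noiseLaw n σw)).map (S.step t)

/-- The law of the full trajectory `(u_{0:N-1}, x_{0:N})`. -/
noncomputable def trajectoryLaw {n p N : ℕ} (σw : ℝ) (S : LTISystem n p)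
    (π : StabilizationAlgorithm n p N) : Measure (Trajectory n p N) :=
  lawUpTo σw S π N le_rfl

/-- The gain `K` stabilizes `S`: the spectral radius of `A + B K` (over `ℂ`) is less than one. -/
def LTISystem.IsStabilizedBy {n p : ℕ} (S : LTISystem n p) (K : Matrix (Fin p) (Fin n) ℝ) : Prop :=
  spectralRadius ℂ ((S.A + S.B * K).map (algebraMap ℝ ℂ)) < 1

open scoped Matrix.Norms.L2Operator in
/-- The spectral norms of the matrices of all systems in the classes `C k`, `k ≥ 1`, are at
most `M`. -/
def SystemClassBoundedBy {p : ℕ} (C : (k : ℕ) → Set (LTISystem k p)) (M : ℝ) : Prop :=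
  ∀ k, 1 ≤ k → ∀ S ∈ C k, ‖S.A‖ ≤ M ∧ ‖S.B‖ ≤ M

/-- On every system of the class, all inputs generated by the algorithm satisfy
`E ‖u_t‖₂² ≤ σu²`. -/
def StabilizationAlgorithm.InputBoundedOn {n p N : ℕ} (π : StabilizationAlgorithm n p N) (σw σu : ℝ)
    (C : Set (LTISystem n p)) : Prop :=
  ∀ S ∈ C, ∀ t : Fin N,
    ∫⁻ h, ‖WithLp.toLp 2 (h.1 t)‖ₑ ^ 2 ∂(trajectoryLaw σw S π) ≤ ENNReal.ofReal (σu ^ 2)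

/-- The single-input system whose `A` has `(1,1)` entry `r`, superdiagonal entries `v` and zeros
elsewhere, and whose `B` is `(b, 0, …, 0, v)ᵀ`. -/
def hardSystem (n : ℕ) (r v b : ℝ) : LTISystem n 1 where
  A := Matrix.of fun i j =>
    if (i : ℕ) = 0 ∧ (j : ℕ) = 0 then r else if (j : ℕ) = i + 1 then v else 0
  B := Matrix.of fun i _ => if (i : ℕ) = 0 then b else if (i : ℕ) + 1 = n then v else 0

/-! The two systems differ only in one entry `m` of `B`, exponentially small in `n`, yet no gain
stabilizes both. If `K` stabilizes the first, all eigenvalues lie at distance at least `r - 1` from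
`r`, while the characteristic polynomial at `r` equals `-(K 0 0 * v ^ n)`; hence `|K 0 0| ≥ ((r - 1)
/ v) ^ n`. If `K` also stabilized the second, both traces would be at most `n` in absolute value, so
their difference `m * K 0 0` would be at most `2 * n`; but it is at least `2 * 2 ^ n`
(`hardSystem_gain_incompatible`).

A reliable algorithm therefore tests one system against the other with both errors at most `δ`,
which forces the relative entropy of the trajectory laws to be at least `log (1 / (3 * δ))`
(`binary_relative_entropy_le`, `log_inv_three_mul_le`). On the other hand, changing the entry of `B`
only shifts the first noise coordinate by `m * u`, so each sample contributes at most `m ^ 2 * σu ^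
2 / (2 * σw ^ 2)` to that entropy (`exists_logLikelihoodRatio`). Comparing the two bounds gives the
estimate on `N`. -/

/-! ### Spectral constraints on stabilizing gains -/

section Spectral

variable {n : ℕ} {M : Matrix (Fin n) (Fin n) ℂ}

lemma norm_lt_one_of_mem_roots_charpoly (hM : spectralRadius ℂ M < 1) {z : ℂ}
    (hz : z ∈ M.charpoly.roots) : ‖z‖ < 1 := by
  have hs : z ∈ spectrum ℂ M :=
    Matrix.mem_spectrum_iff_isRoot_charpoly.2 (Polynomial.isRoot_of_mem_roots hz)
  have hle : (‖z‖₊ : ℝ≥0∞) ≤ spectralRadius ℂ M :=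
    le_iSup₂ (f := fun (k : ℂ) (_ : k ∈ spectrum ℂ M) => (‖k‖₊ : ℝ≥0∞)) z hs
  have := hle.trans_lt hM
  exact_mod_cast this

lemma card_roots_charpoly (M : Matrix (Fin n) (Fin n) ℂ) :
    Multiset.card M.charpoly.roots = n := by
  rw [← (IsAlgClosed.splits M.charpoly).natDegree_eq_card_roots, Matrix.charpoly_natDegree_eq_dim,
    Fintype.card_fin]

/-- The trace of a Schur stable matrix is bounded by the dimension. -/
lemma norm_trace_le_of_spectralRadius_lt_one (hM : spectralRadius ℂ M < 1) : ‖M.trace‖ ≤ n := by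
  rw [Matrix.trace_eq_sum_roots_charpoly]
  calc ‖M.charpoly.roots.sum‖ ≤ (M.charpoly.roots.map fun z => ‖z‖).sum :=
        norm_multiset_sum_le _
    _ ≤ Multiset.card (M.charpoly.roots.map fun z => ‖z‖) • (1 : ℝ) := by
        refine Multiset.sum_le_card_nsmul _ _ fun x hx => ?_
        obtain ⟨z, hz, rfl⟩ := Multiset.mem_map.1 hx
        exact (norm_lt_one_of_mem_roots_charpoly hM hz).le
    _ = n := by simp [card_roots_charpoly]

/-- The characteristic polynomial of a Schur stable matrix is at least `(r - 1) ^ n` at `r > 1`. -/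
lemma pow_le_norm_eval_charpoly (hM : spectralRadius ℂ M < 1) {r : ℝ} (hr : 1 < r) :
    (r - 1) ^ n ≤ ‖M.charpoly.eval (r : ℂ)‖ := by
  have key : ∀ s : Multiset ℂ, (∀ z ∈ s, ‖z‖ < 1) →
      (r - 1) ^ Multiset.card s ≤ ‖(s.map fun z => (r : ℂ) - z).prod‖ := by
    intro s
    induction s using Multiset.induction with
    | empty => simp
    | cons a s ih =>
      intro h
      rw [Multiset.card_cons, Multiset.map_cons, Multiset.prod_cons, norm_mul, pow_succ']
      refine mul_le_mul ?_ (ih fun z hz => h z (Multiset.mem_cons_of_mem hz))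
        (pow_nonneg (by linarith) _) (norm_nonneg _)
      have h1 := norm_sub_norm_le (r : ℂ) a
      rw [Complex.norm_real, Real.norm_of_nonneg (by linarith)] at h1
      have h2 := h a (Multiset.mem_cons_self a s)
      linarith
  have := key M.charpoly.roots fun z hz => norm_lt_one_of_mem_roots_charpoly hM hz
  rw [card_roots_charpoly] at this
  rwa [(IsAlgClosed.splits M.charpoly).eval_eq_prod_roots_of_monic M.charpoly_monic]

end Spectral

/-! ### Trace and characteristic polynomial of the hard closed loops -/

section HardSystem

variable {k : ℕ} {r v : ℝ}

lemma hardSystem_trace (b : ℝ) (K : Matrix (Fin 1) (Fin (k + 2)) ℝ) :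
    ((hardSystem (k + 2) r v b).A + (hardSystem (k + 2) r v b).B * K).trace
      = r + b * K 0 0 + v * K 0 (Fin.last (k + 1)) := by
  rw [Matrix.trace_add]
  have hA : (hardSystem (k + 2) r v b).A.trace = r := by
    rw [Matrix.trace, Fin.sum_univ_succ]
    simp [hardSystem]
  have hB : ((hardSystem (k + 2) r v b).B * K).trace = b * K 0 0 + v * K 0 (Fin.last (k + 1)) := by
    rw [Matrix.trace, Fin.sum_univ_succ, Fin.sum_univ_castSucc]
    have : ∀ i : Fin k, (i : ℕ) ≠ k := fun i => i.2.ne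
    simp [hardSystem, Matrix.mul_apply, this]
  rw [hA, hB, add_assoc]

lemma hardSystem_zero_charmatrix_apply (K : Matrix (Fin 1) (Fin (k + 2)) ℝ) (i j : Fin (k + 2)) :
    (Matrix.scalar (Fin (k + 2)) r -
      ((hardSystem (k + 2) r v 0).A + (hardSystem (k + 2) r v 0).B * K)) i j
      = (if (i : ℕ) = j then r else 0) -
        ((if (i : ℕ) = 0 ∧ (j : ℕ) = 0 then r else if (j : ℕ) = i + 1 then v else 0) +
          (if (i : ℕ) = k + 1 then v else 0) * K 0 j) := by
  have h : (if (i : ℕ) = 0 then 0 else if (i : ℕ) + 1 = k + 2 then v else 0)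
      = if (i : ℕ) = k + 1 then v else 0 := by
    split_ifs <;> first | rfl | omega
  simp only [Matrix.sub_apply, Matrix.add_apply, Matrix.scalar_apply, Matrix.diagonal_apply,
    Matrix.mul_apply, hardSystem, Matrix.of_apply, Fin.ext_iff, Finset.univ_unique,
    Finset.sum_singleton, h]
  rfl

/-- At the point `r` the corner entry of `A` cancels, so the first column of the characteristic
matrix vanishes except in the last row, where the input enters. Deleting that column and row leaves
a lower triangular matrix with diagonal `-v`. -/
lemma hardSystem_zero_eval_charpoly (K : Matrix (Fin 1) (Fin (k + 2)) ℝ) :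
    ((hardSystem (k + 2) r v 0).A + (hardSystem (k + 2) r v 0).B * K).charpoly.eval r
      = -(K 0 0 * v ^ (k + 2)) := by
  rw [Matrix.eval_charpoly, Matrix.det_succ_column_zero, Fin.sum_univ_castSucc]
  set D := Matrix.scalar (Fin (k + 2)) r -
    ((hardSystem (k + 2) r v 0).A + (hardSystem (k + 2) r v 0).B * K) with hD
  have hcol : ∀ i : Fin (k + 1), D i.castSucc 0 = 0 := by
    intro i
    have hi : (i : ℕ) ≠ k + 1 := i.2.ne
    rw [hD, hardSystem_zero_charmatrix_apply]
    by_cases h0 : (i : ℕ) = 0 <;> simp [h0, hi]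
  have hlast : D (Fin.last (k + 1)) 0 = -(v * K 0 0) := by
    rw [hD, hardSystem_zero_charmatrix_apply]
    simp
  have hdet : (D.submatrix (Fin.last (k + 1)).succAbove Fin.succ).det = (-v) ^ (k + 1) := by
    rw [Matrix.det_of_isLowerTriangular]
    · have : ∀ i : Fin (k + 1), D i.castSucc i.succ = -v := by
        intro i
        have hi : (i : ℕ) ≠ k + 1 := i.2.ne
        rw [hD, hardSystem_zero_charmatrix_apply]
        simp [hi]
      simp [this]
    · intro i j hij
      have hi : (i : ℕ) ≠ k + 1 := i.2.ne
      have hij' : (i : ℕ) < j := hij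
      have h1 : (i : ℕ) ≠ j + 1 := by omega
      have h2 : (j : ℕ) ≠ i := by omega
      rw [Matrix.submatrix_apply, Fin.succAbove_last, hD, hardSystem_zero_charmatrix_apply]
      simp [hi, h1, h2]
  simp only [hcol, hlast, hdet, mul_zero, zero_mul, Finset.sum_const_zero, zero_add, Fin.val_last]
  have : (-1 : ℝ) ^ (k + 1) * (-v) ^ (k + 1) = v ^ (k + 1) := by rw [← mul_pow]; simp
  calc _ = -(v * K 0 0) * ((-1 : ℝ) ^ (k + 1) * (-v) ^ (k + 1)) := by ring
    _ = _ := by rw [this]; ring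

lemma LTISystem.IsStabilizedBy.abs_trace_le {n : ℕ} {S : LTISystem n 1}
    {K : Matrix (Fin 1) (Fin n) ℝ} (h : S.IsStabilizedBy K) : |(S.A + S.B * K).trace| ≤ n := by
  have := norm_trace_le_of_spectralRadius_lt_one h
  have h2 : ((S.A + S.B * K).map (algebraMap ℝ ℂ)).trace = ((S.A + S.B * K).trace : ℂ) := by
    simp [Matrix.trace]
  rwa [h2, Complex.norm_real] at this

lemma LTISystem.IsStabilizedBy.pow_le_abs_eval_charpoly {n : ℕ} {S : LTISystem n 1}
    {K : Matrix (Fin 1) (Fin n) ℝ} (h : S.IsStabilizedBy K) (hr : 1 < r) :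
    (r - 1) ^ n ≤ |(S.A + S.B * K).charpoly.eval r| := by
  have := pow_le_norm_eval_charpoly h hr
  rw [Matrix.charpoly_map, Polynomial.eval_map_algebraMap] at this
  rw [← Real.norm_eq_abs, ← Complex.norm_real]
  convert this using 2
  exact (Polynomial.aeval_algebraMap_apply_eq_algebraMap_eval (A := ℂ) r _).symm

/-- The two hard systems cannot satisfy these consequences of stability with a common gain. -/
lemma hardSystem_gain_incompatible {n : ℕ} (hr : 1 < r) (hv : 0 < v) {a c : ℝ}
    (ha : (r - 1) ^ n ≤ |a| * v ^ n) (h₁ : |r + v * c| ≤ n)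
    (h₂ : |r + 2 * (2 * v / (r - 1)) ^ n * a + v * c| ≤ n) : False := by
  have hr0 : 0 < r - 1 := by linarith
  have h3 : |2 * (2 * v / (r - 1)) ^ n * a| ≤ 2 * n := by
    have := abs_sub (r + 2 * (2 * v / (r - 1)) ^ n * a + v * c) (r + v * c)
    rw [show r + 2 * (2 * v / (r - 1)) ^ n * a + v * c - (r + v * c)
      = 2 * (2 * v / (r - 1)) ^ n * a by ring] at this
    linarith
  rw [abs_mul, abs_of_nonneg (by positivity)] at h3
  -- This is `ha` multiplied by `(2 / (r - 1)) ^ n`; with `h3` it would give `2 ^ n ≤ n`.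
  have h4 : (2 : ℝ) ^ n ≤ (2 * v / (r - 1)) ^ n * |a| := by
    rw [div_pow, mul_pow, div_mul_eq_mul_div, le_div_iff₀ (by positivity), mul_assoc]
    gcongr
    linarith
  have h5 : (n : ℝ) < 2 ^ n := by exact_mod_cast n.lt_two_pow_self
  linarith

end HardSystem

/-! ### A two-point testing inequality -/

/-- For `δ ≥ 1/3` the left side is nonpositive. Otherwise the right side minus the left equals `log
3 - log (1 - δ)` minus twice the binary entropy of `δ`. Gibbs' inequality against the distribution
`(1/4, 3/4)` bounds the entropy by a function affine in `δ`, and the resulting bound is checked at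
`δ = 1/3`. -/
lemma log_inv_three_mul_le {δ : ℝ} (hδ₀ : 0 < δ) (hδ₁ : δ < 1 / 2) :
    Real.log (1 / (3 * δ)) ≤ (1 - 2 * δ) * Real.log ((1 - δ) / δ) := by
  rcases le_or_gt (1 / 3) δ with h | h
  · have h1 : Real.log (1 / (3 * δ)) ≤ 0 := by
      apply Real.log_nonpos (by positivity)
      rw [div_le_one (by positivity)]; linarith
    have h2 : 0 ≤ Real.log ((1 - δ) / δ) := by
      apply Real.log_nonneg
      rw [le_div_iff₀ hδ₀]; linarith
    exact h1.trans (mul_nonneg (by linarith) h2)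
  · have hδ' : 0 < 1 - δ := by linarith
    have hg : ∀ x y : ℝ, 0 < x → 0 < y → x * Real.log y - x * Real.log x ≤ y - x := by
      intro x y hx hy
      have := Real.log_le_sub_one_of_pos (div_pos hy hx)
      rw [Real.log_div hy.ne' hx.ne'] at this
      have := mul_le_mul_of_nonneg_left this hx.le
      have e : x * (y / x - 1) = y - x := by field_simp
      linarith
    have g1 := hg δ (1 / 4) hδ₀ (by norm_num)
    have g2 := hg (1 - δ) (3 / 4) hδ' (by norm_num)
    have g3 : Real.log (1 - δ) ≤ -δ := by
      have := Real.log_le_sub_one_of_pos hδ'; linarith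
    have e1 : Real.log (1 / 4) = -(2 * Real.log 2) := by
      rw [one_div, Real.log_inv, show (4 : ℝ) = 2 ^ 2 by norm_num, Real.log_pow]; norm_num
    have e2 : Real.log (3 / 4) = Real.log 3 - 2 * Real.log 2 := by
      rw [Real.log_div (by norm_num) (by norm_num), show (4 : ℝ) = 2 ^ 2 by norm_num,
        Real.log_pow]; norm_num
    have e3 : 11 * Real.log 2 ≤ 7 * Real.log 3 := by
      have := Real.log_le_log (by norm_num) (show (2 : ℝ) ^ 11 ≤ 3 ^ 7 by norm_num)
      rw [Real.log_pow, Real.log_pow] at this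
      exact_mod_cast this
    have e4 := Real.log_two_lt_d9
    have e5 := Real.log_two_gt_d9
    rw [e1] at g1
    rw [e2] at g2
    rw [one_div, Real.log_inv, Real.log_mul (by norm_num) hδ₀.ne',
      Real.log_div hδ'.ne' hδ₀.ne']
    have e6 : 0 ≤ (1 / 3 - δ) * (2 * Real.log 3 - 1) :=
      mul_nonneg (by linarith) (by linarith)
    linarith

/-- If `ν` has density `exp L` with respect to `μ`, then a test that succeeds with probability
at least `1 - δ` under both measures forces `KL(μ, ν) = -∫ L ∂μ` to be large. -/
lemma binary_relative_entropy_le {Ω : Type*} [MeasurableSpace Ω] {μ ν : Measure Ω}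
    [IsProbabilityMeasure μ] [IsProbabilityMeasure ν] {L : Ω → ℝ}
    (hL : Integrable L μ) (hν : ν = μ.withDensity fun x => ENNReal.ofReal (Real.exp (L x)))
    {E : Set Ω} (hE : MeasurableSet E) {δ : ℝ} (hδ₀ : 0 < δ) (hδ₁ : δ < 1 / 2)
    (hμE : 1 - δ ≤ μ.real E) (hνE : ν.real E ≤ δ) :
    (1 - 2 * δ) * Real.log ((1 - δ) / δ) ≤ -∫ x, L x ∂μ := by
  set k : ℝ := (1 - δ) / δ with hk
  have hk1 : 1 ≤ k := by rw [hk, le_div_iff₀ hδ₀]; linarith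
  have hk0 : 0 < k := by linarith
  have hlog : 0 ≤ Real.log k := Real.log_nonneg hk1
  -- Test function for the Donsker–Varadhan bound `∫ (L + g) ∂μ ≤ log ∫ exp g ∂ν`. Up to a constant
  -- it is the log-likelihood ratio of Bernoulli laws with parameters `1 - δ` and `δ`, and it makes
  -- the right side at most `log k`.
  let g : Ω → ℝ := E.indicator fun _ => 2 * Real.log k
  have hg : Integrable g μ := (integrable_const _).indicator hE
  have hexp : ∀ x, Real.exp (g x) = 1 + E.indicator (fun _ => k ^ 2 - 1) x := by
    intro x
    by_cases hx : x ∈ E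
    · simp [g, hx, two_mul, Real.exp_add, Real.exp_log hk0, sq]
    · simp [g, hx]
  have hgν : Integrable (fun x => Real.exp (g x)) ν := by
    simp_rw [hexp]
    exact (integrable_const _).add ((integrable_const _).indicator hE)
  have hZ : ∫ x, Real.exp (g x) ∂ν ≤ k := by
    simp_rw [hexp]
    rw [integral_add (integrable_const _) ((integrable_const _).indicator hE),
      integral_indicator_const _ hE]
    have h1 : ν.real E * (k ^ 2 - 1) ≤ δ * (k ^ 2 - 1) :=
      mul_le_mul_of_nonneg_right hνE (by nlinarith)
    have h2 : 1 + δ * (k ^ 2 - 1) = k := by rw [hk]; field_simp; ring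
    simp only [integral_const, probReal_univ, smul_eq_mul]
    linarith
  have hdm : AEMeasurable (fun x => ENNReal.ofReal (Real.exp (L x))) μ :=
    (Real.measurable_exp.comp_aemeasurable hL.aemeasurable).ennreal_ofReal
  have hint : Integrable (fun x => Real.exp (L x) * Real.exp (g x)) μ := by
    rw [hν, integrable_withDensity_iff_integrable_smul₀' hdm (by simp)] at hgν
    simpa [ENNReal.toReal_ofReal (Real.exp_nonneg _)] using hgν
  have hval : ∫ x, Real.exp (g x) ∂ν = ∫ x, Real.exp (L x) * Real.exp (g x) ∂μ := by
    rw [hν, integral_withDensity_eq_integral_toReal_smul₀ hdm (by simp)]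
    simp [ENNReal.toReal_ofReal (Real.exp_nonneg _)]
  -- The tangent line of `exp` at `log k` takes the place of Jensen's inequality.
  have hpt : ∀ x, L x + g x + (1 - Real.log k) ≤ k⁻¹ * (Real.exp (L x) * Real.exp (g x)) := by
    intro x
    have := Real.add_one_le_exp (L x + g x - Real.log k)
    rw [Real.exp_sub, Real.exp_add, Real.exp_log hk0, div_eq_inv_mul] at this
    linarith
  have hmono := integral_mono ((hL.add hg).add (integrable_const _)) (hint.const_mul k⁻¹) hpt
  have hlhs : ∫ x, (L x + g x + (1 - Real.log k)) ∂μ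
      = ∫ x, L x ∂μ + μ.real E * (2 * Real.log k) + (1 - Real.log k) := by
    rw [integral_add (f := fun x => L x + g x) (hL.add hg) (integrable_const _),
      integral_add hL hg,
      integral_indicator_const _ hE]
    simp
  have hrhs : ∫ x, k⁻¹ * (Real.exp (L x) * Real.exp (g x)) ∂μ ≤ 1 := by
    rw [integral_const_mul, ← hval, inv_mul_le_iff₀ hk0]
    linarith
  have hle : ∫ x, (L x + g x + (1 - Real.log k)) ∂μ ≤ 1 := hmono.trans hrhs
  rw [hlhs] at hle
  have : (1 - δ) * (2 * Real.log k) ≤ μ.real E * (2 * Real.log k) :=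
    mul_le_mul_of_nonneg_right hμE (by linarith)
  linarith

/-! ### Shifting Gaussian noise -/

instance (n : ℕ) (σ : ℝ) : IsProbabilityMeasure (noiseLaw n σ) := by
  unfold noiseLaw; infer_instance

/-- The exponential factor is the density of `N(c, σ²)` with respect to `N(0, σ²)`, obtained by
expanding `(y - c) ^ 2`. -/
lemma lintegral_gaussianReal_add_const {σ : ℝ} (hσ : 0 < σ) (c : ℝ) {f : ℝ → ℝ≥0∞}
    (hf : Measurable f) :
    ∫⁻ y, f (y + c) ∂gaussianReal 0 (σ ^ 2).toNNReal
      = ∫⁻ y, f y * ENNReal.ofReal (Real.exp (c * y / σ ^ 2 - c ^ 2 / (2 * σ ^ 2)))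
        ∂gaussianReal 0 (σ ^ 2).toNNReal := by
  have hv : (σ ^ 2).toNNReal ≠ 0 := by
    rw [Ne, Real.toNNReal_eq_zero, not_le]; positivity
  have hmap := gaussianReal_map_add_const (μ := 0) (v := (σ ^ 2).toNNReal) c
  rw [← lintegral_map hf (measurable_add_const c), hmap, gaussianReal_of_var_ne_zero _ hv,
    gaussianReal_of_var_ne_zero _ hv,
    lintegral_withDensity_eq_lintegral_mul _ (measurable_gaussianPDF _ _) hf,
    lintegral_withDensity_eq_lintegral_mul _ (measurable_gaussianPDF _ _) (by fun_prop)]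
  refine lintegral_congr fun y => ?_
  simp only [Pi.mul_apply, gaussianPDF]
  rw [mul_comm (f y), ← mul_assoc, ← ENNReal.ofReal_mul (gaussianPDFReal_nonneg _ _ _)]
  congr 2
  simp only [gaussianPDFReal]
  rw [mul_assoc _ (Real.exp _), ← Real.exp_add, Real.coe_toNNReal _ (by positivity)]
  congr 2
  field_simp
  ring

/-- The coordinates are independent and only the first one moves, so Fubini reduces this to the
scalar shift. -/
lemma lintegral_noiseLaw_add_single {n : ℕ} {σ : ℝ} (hσ : 0 < σ) (c : ℝ)
    {f : (Fin (n + 1) → ℝ) → ℝ≥0∞} (hf : Measurable f) :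
    ∫⁻ w, f (w + Pi.single 0 c) ∂noiseLaw (n + 1) σ
      = ∫⁻ w, f w * ENNReal.ofReal (Real.exp (c * w 0 / σ ^ 2 - c ^ 2 / (2 * σ ^ 2)))
        ∂noiseLaw (n + 1) σ := by
  have hsplit : ∀ F : (Fin (n + 1) → ℝ) → ℝ≥0∞, Measurable F →
      ∫⁻ w, F w ∂noiseLaw (n + 1) σ = ∫⁻ z, ∫⁻ y, F (Fin.cons y z)
        ∂gaussianReal 0 (σ ^ 2).toNNReal ∂noiseLaw n σ := by
    intro F hF
    have hmp := (measurePreserving_piFinSuccAbove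
      (fun _ : Fin (n + 1) => gaussianReal 0 (σ ^ 2).toNNReal) 0).symm
    have hcons : ∀ p : ℝ × (Fin n → ℝ),
        (MeasurableEquiv.piFinSuccAbove (fun _ : Fin (n + 1) => ℝ) 0).symm p
          = Fin.cons p.1 p.2 := by
      intro p
      simp [MeasurableEquiv.piFinSuccAbove, Fin.insertNthEquiv]
    have := hmp.lintegral_comp hF
    rw [noiseLaw, ← this, lintegral_prod_symm' _ (by fun_prop)]
    simp only [hcons]
    rfl
  refine (hsplit _ (hf.comp (measurable_add_const _))).trans ?_
  rw [hsplit _ (by fun_prop)]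
  refine lintegral_congr fun z => ?_
  have hcons : Measurable fun y : ℝ => (Fin.cons y z : Fin (n + 1) → ℝ) := by
    refine measurable_pi_lambda _ fun i => ?_
    refine Fin.cases ?_ (fun j => ?_) i
    · simpa only [Fin.cons_zero] using measurable_id'
    · simp
  refine Eq.trans ?_ (lintegral_gaussianReal_add_const hσ c (hf.comp hcons))
  refine lintegral_congr fun y => congrArg f ?_
  ext i
  refine Fin.cases ?_ (fun j => ?_) i <;> simp

lemma memLp_two_noiseLaw_apply (n : ℕ) (σ : ℝ) (i : Fin n) :
    MemLp (fun w : Fin n → ℝ => w i) 2 (noiseLaw n σ) :=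
  (memLp_id_gaussianReal (μ := 0) (v := (σ ^ 2).toNNReal) 2).comp_measurePreserving
    (measurePreserving_eval (fun _ : Fin n => gaussianReal 0 (σ ^ 2).toNNReal) i)

lemma integral_noiseLaw_apply (n : ℕ) (σ : ℝ) (i : Fin n) :
    ∫ w : Fin n → ℝ, w i ∂noiseLaw n σ = 0 := by
  have hmp := measurePreserving_eval (fun _ : Fin n => gaussianReal 0 (σ ^ 2).toNNReal) i
  have h := integral_map (μ := noiseLaw n σ) (φ := Function.eval i) (f := fun y : ℝ => y)
    (measurable_pi_apply i).aemeasurable (by fun_prop)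
  rw [noiseLaw, hmp.map_eq, integral_id_gaussianReal] at h
  exact h.symm

/-! ### The trajectory laws -/

section TrajectoryLaw

variable {n p N : ℕ} {σw : ℝ}

lemma LTISystem.measurable_step (S : LTISystem n p) (t : ℕ) : Measurable (S.step t) := by
  refine Measurable.prodMk ?_ ?_
  · refine measurable_pi_lambda _ fun i => ?_
    refine Fin.lastCases ?_ (fun j => ?_) i
    · simp only [Fin.snoc_last]; fun_prop
    · simp only [Fin.snoc_castSucc]; fun_prop
  · refine measurable_pi_lambda _ fun i => ?_
    refine Fin.lastCases ?_ (fun j => ?_) i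
    · simp only [Fin.snoc_last]
      refine measurable_pi_lambda _ fun l => ?_
      simp only [Pi.add_apply, Matrix.mulVec, dotProduct]
      fun_prop
    · simp only [Fin.snoc_castSucc]; fun_prop

instance isProbabilityMeasure_lawUpTo (S : LTISystem n p) (π : StabilizationAlgorithm n p N) :
    ∀ (t : ℕ) (ht : t ≤ N), IsProbabilityMeasure (lawUpTo σw S π t ht)
  | 0, _ => by unfold lawUpTo; infer_instance
  | t + 1, ht => by
    have := isProbabilityMeasure_lawUpTo S π t (Nat.le_of_succ_le ht)
    have := π.isMarkovKernel_explore ⟨t, ht⟩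
    unfold lawUpTo
    exact Measure.isProbabilityMeasure_map (S.measurable_step t).aemeasurable

lemma lintegral_lawUpTo_succ (S : LTISystem n p) (π : StabilizationAlgorithm n p N) (t : ℕ)
    (ht : t + 1 ≤ N) {f : Trajectory n p (t + 1) → ℝ≥0∞} (hf : Measurable f) :
    ∫⁻ h, f h ∂lawUpTo σw S π (t + 1) ht
      = ∫⁻ h, ∫⁻ u, ∫⁻ w, f (S.step t ((h, u), w)) ∂noiseLaw n σw ∂π.explore ⟨t, ht⟩ h
        ∂lawUpTo σw S π t (Nat.le_of_succ_le ht) := by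
  have := π.isMarkovKernel_explore ⟨t, ht⟩
  have hstep := S.measurable_step t
  rw [lawUpTo, lintegral_map hf hstep,
    lintegral_prod (fun q => f (S.step t q)) (hf.comp hstep).aemeasurable,
    Measure.lintegral_compProd]
  exact (hf.comp hstep).lintegral_prod_right'

/-- The law of the input `u_s` does not depend on the horizon. -/
lemma lintegral_input_lawUpTo (S : LTISystem n p) (π : StabilizationAlgorithm n p N)
    {g : (Fin p → ℝ) → ℝ≥0∞} (hg : Measurable g) {s : ℕ} :
    ∀ (t : ℕ) (hs : s < t) (ht : t ≤ N), ∫⁻ h, g (h.1 ⟨s, hs⟩) ∂lawUpTo σw S π t ht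
      = ∫⁻ q, g q.2 ∂(lawUpTo σw S π s (hs.le.trans ht) ⊗ₘ π.explore ⟨s, hs.trans_le ht⟩)
  | 0, hs, _ => absurd hs (Nat.not_lt_zero _)
  | t + 1, hs, ht => by
    have := π.isMarkovKernel_explore
    rw [lintegral_lawUpTo_succ S π t ht (by fun_prop)]
    rcases Nat.lt_succ_iff_lt_or_eq.1 hs with hlt | rfl
    · have h1 : (⟨s, hs⟩ : Fin (t + 1)) = Fin.castSucc ⟨s, hlt⟩ := rfl
      simp only [LTISystem.step, h1, Fin.snoc_castSucc, lintegral_const, measure_univ, mul_one]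
      exact lintegral_input_lawUpTo S π hg t hlt _
    · have h1 : (⟨s, hs⟩ : Fin (s + 1)) = Fin.last s := rfl
      simp only [LTISystem.step, h1, Fin.snoc_last, lintegral_const, measure_univ, mul_one]
      rw [Measure.lintegral_compProd (by fun_prop)]

end TrajectoryLaw

/-! ### The likelihood ratio of two systems that differ in one entry of `B` -/

section LikelihoodRatio

variable {k N : ℕ} {σw : ℝ}

/-- The trajectory without its last input and state. -/
def Trajectory.init {n p t : ℕ} (h : Trajectory n p (t + 1)) : Trajectory n p t :=
  (fun i => h.1 i.castSucc, fun i => h.2 i.castSucc)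

lemma Trajectory.measurable_init {n p t : ℕ} :
    Measurable (Trajectory.init : Trajectory n p (t + 1) → Trajectory n p t) := by
  unfold Trajectory.init; fun_prop

lemma Trajectory.init_step {n p t : ℕ} (S : LTISystem n p)
    (q : (Trajectory n p t × (Fin p → ℝ)) × (Fin n → ℝ)) : Trajectory.init (S.step t q) = q.1.1 := by
  simp [Trajectory.init, LTISystem.step]

/-- The first coordinate of the last noise vector, reconstructed from the trajectory. -/
def LTISystem.lastNoise {p t : ℕ} (S : LTISystem (k + 1) p) (h : Trajectory (k + 1) p (t + 1)) : ℝ :=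
  (h.2 (Fin.last (t + 1)) - (S.A.mulVec (h.2 (Fin.last t).castSucc) +
    S.B.mulVec (h.1 (Fin.last t)))) 0

lemma LTISystem.measurable_lastNoise {p t : ℕ} (S : LTISystem (k + 1) p) :
    Measurable (S.lastNoise (t := t)) := by
  unfold LTISystem.lastNoise
  simp only [Pi.sub_apply, Pi.add_apply, Matrix.mulVec, dotProduct]
  fun_prop

lemma LTISystem.lastNoise_step {p t : ℕ} (S : LTISystem (k + 1) p)
    (q : (Trajectory (k + 1) p t × (Fin p → ℝ)) × (Fin (k + 1) → ℝ)) :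
    S.lastNoise (S.step t q) = q.2 0 := by
  simp [LTISystem.lastNoise, LTISystem.step]

/-- The system obtained by adding `m` to the entry of `B` that maps the input to the first state. -/
def LTISystem.perturb (S : LTISystem (k + 1) 1) (m : ℝ) : LTISystem (k + 1) 1 where
  A := S.A
  B := S.B + Matrix.of fun i _ => if i = 0 then m else 0

/-- With the past and the input fixed, the two systems become one system driven by differently
centred Gaussian noise. -/
lemma LTISystem.perturb_step (S : LTISystem (k + 1) 1) (m : ℝ) {t : ℕ}
    (h : Trajectory (k + 1) 1 t) (u : Fin 1 → ℝ) (w : Fin (k + 1) → ℝ) :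
    (S.perturb m).step t ((h, u), w) = S.step t ((h, u), w + Pi.single 0 (m * u 0)) := by
  have : (S.perturb m).B.mulVec u = S.B.mulVec u + Pi.single 0 (m * u 0) := by
    ext i
    simp only [perturb, Matrix.add_apply, Pi.add_apply, Matrix.mulVec, dotProduct,
      Finset.univ_unique, Finset.sum_singleton, Matrix.of_apply, Pi.single_apply, add_mul, ite_mul,
      zero_mul]
    rfl
  simp only [LTISystem.step, this]
  congr 2
  simp only [perturb]
  abel

/-- The contribution to the log-likelihood ratio of an input `u` followed by noise `w`. -/
noncomputable def logRatioStep (σw m u w : ℝ) : ℝ :=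
  m * u * w / σw ^ 2 - (m * u) ^ 2 / (2 * σw ^ 2)

/-- The exploration kernel is the same for both systems and contributes nothing to the ratio; only
the shifted noise does. The noise is reconstructed with the unperturbed `S`, whose law is the
reference measure. -/
lemma lawUpTo_perturb_succ_eq_withDensity (hσw : 0 < σw) (S : LTISystem (k + 1) 1) (m : ℝ)
    (π : StabilizationAlgorithm (k + 1) 1 N) {t : ℕ} (ht : t + 1 ≤ N)
    {L : Trajectory (k + 1) 1 t → ℝ} (hL : Measurable L)
    (h : lawUpTo σw (S.perturb m) π t (Nat.le_of_succ_le ht) =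
      (lawUpTo σw S π t (Nat.le_of_succ_le ht)).withDensity
        fun h => ENNReal.ofReal (Real.exp (L h))) :
    lawUpTo σw (S.perturb m) π (t + 1) ht = (lawUpTo σw S π (t + 1) ht).withDensity
      fun h => ENNReal.ofReal (Real.exp (L (Trajectory.init h) +
        logRatioStep σw m (h.1 (Fin.last t) 0) (S.lastNoise h))) := by
  have := π.isMarkovKernel_explore ⟨t, ht⟩
  have hinit : Measurable (Trajectory.init : Trajectory (k + 1) 1 (t + 1) → _) :=
    Trajectory.measurable_init
  have hnoise := S.measurable_lastNoise (t := t)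
  have hd : Measurable fun h : Trajectory (k + 1) 1 (t + 1) =>
      ENNReal.ofReal (Real.exp (L (Trajectory.init h) +
        logRatioStep σw m (h.1 (Fin.last t) 0) (S.lastNoise h))) := by
    unfold logRatioStep; fun_prop
  refine Measure.ext_of_lintegral _ fun f hf => ?_
  rw [lintegral_withDensity_eq_lintegral_mul _ hd hf, lintegral_lawUpTo_succ _ _ _ _ hf,
    lintegral_lawUpTo_succ _ _ _ _ (hd.mul hf), h]
  have hstep := S.measurable_step t
  have hstep' := (S.perturb m).measurable_step t
  rw [lintegral_withDensity_eq_lintegral_mul _ (by fun_prop)]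
  swap
  · exact Measurable.lintegral_kernel_prod_right'
      (f := fun q : Trajectory (k + 1) 1 t × (Fin 1 → ℝ) =>
        ∫⁻ w, f ((S.perturb m).step t (q, w)) ∂noiseLaw (k + 1) σw)
      (hf.comp hstep').lintegral_prod_right'
  refine lintegral_congr fun x => ?_
  rw [Pi.mul_apply, ← lintegral_const_mul]
  swap
  · exact ((hf.comp hstep').lintegral_prod_right' (ν := noiseLaw (k + 1) σw)).comp
      measurable_prodMk_left
  refine lintegral_congr fun u => ?_
  have hfx : Measurable fun w => f (S.step t ((x, u), w)) :=
    hf.comp (hstep.comp measurable_prodMk_left)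
  simp_rw [LTISystem.perturb_step]
  rw [lintegral_noiseLaw_add_single hσw _ hfx, ← lintegral_const_mul _ (by fun_prop)]
  refine lintegral_congr fun w => ?_
  simp only [Pi.mul_apply, Trajectory.init_step, LTISystem.lastNoise_step]
  rw [Real.exp_add, ENNReal.ofReal_mul (Real.exp_nonneg _)]
  simp only [LTISystem.step, Fin.snoc_last, logRatioStep]
  ring

/-- Under the law of `S` the new noise is centred and independent of the input, so the cross term of
`logRatioStep` integrates to zero and only the quadratic term, controlled by the input energy,
remains. -/
lemma integral_logRatio_succ (S : LTISystem (k + 1) 1) (m : ℝ)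
    (π : StabilizationAlgorithm (k + 1) 1 N) {t : ℕ} (ht : t + 1 ≤ N) {σu : ℝ}
    {L : Trajectory (k + 1) 1 t → ℝ} (hLm : Measurable L)
    (hL : Integrable L (lawUpTo σw S π t (Nat.le_of_succ_le ht)))
    (hu : ∫⁻ q, ‖q.2 0‖ₑ ^ 2 ∂(lawUpTo σw S π t (Nat.le_of_succ_le ht) ⊗ₘ π.explore ⟨t, ht⟩)
      ≤ ENNReal.ofReal (σu ^ 2)) :
    Integrable (fun h => L (Trajectory.init h) +
        logRatioStep σw m (h.1 (Fin.last t) 0) (S.lastNoise h)) (lawUpTo σw S π (t + 1) ht) ∧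
      ∫ h, L h ∂lawUpTo σw S π t (Nat.le_of_succ_le ht) - m ^ 2 * σu ^ 2 / (2 * σw ^ 2) ≤
        ∫ h, (L (Trajectory.init h) + logRatioStep σw m (h.1 (Fin.last t) 0) (S.lastNoise h))
          ∂lawUpTo σw S π (t + 1) ht := by
  have := π.isMarkovKernel_explore ⟨t, ht⟩
  set μ := lawUpTo σw S π t (Nat.le_of_succ_le ht) with hμ
  set ρ := μ ⊗ₘ π.explore ⟨t, ht⟩ with hρ
  have hum : Measurable fun q : Trajectory (k + 1) 1 t × (Fin 1 → ℝ) => q.2 0 := by fun_prop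
  have hu2 : MemLp (fun q : Trajectory (k + 1) 1 t × (Fin 1 → ℝ) => q.2 0) 2 ρ := by
    refine ⟨hum.aestronglyMeasurable, ?_⟩
    rw [eLpNorm_lt_top_iff_lintegral_rpow_enorm_lt_top (by norm_num) (by norm_num)]
    simpa using hu.trans_lt ENNReal.ofReal_lt_top
  have hsq : Integrable (fun q : Trajectory (k + 1) 1 t × (Fin 1 → ℝ) => q.2 0 ^ 2) ρ :=
    hu2.integrable_sq
  have hsqle : ∫ q, q.2 0 ^ 2 ∂ρ ≤ σu ^ 2 := by
    rw [integral_eq_lintegral_of_nonneg_ae (Filter.Eventually.of_forall fun _ => sq_nonneg _)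
      hsq.aestronglyMeasurable]
    refine ENNReal.toReal_le_of_le_ofReal (sq_nonneg _) (le_trans (le_of_eq ?_) hu)
    refine lintegral_congr fun q => ?_
    rw [Real.enorm_eq_ofReal_abs, ← ENNReal.ofReal_pow (abs_nonneg _), sq_abs]
  have hLρ : Integrable (fun q : Trajectory (k + 1) 1 t × (Fin 1 → ℝ) => L q.1) ρ := by
    have hfst : ρ.map Prod.fst = μ := Measure.fst_compProd _ _
    rw [← hfst] at hL
    exact hL.comp_measurable measurable_fst
  have hLint : ∫ q, L q.1 ∂ρ = ∫ h, L h ∂μ := by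
    have hfst : ρ.map Prod.fst = μ := Measure.fst_compProd _ _
    rw [← hfst, integral_map measurable_fst.aemeasurable hLm.aestronglyMeasurable]
  have hw := (memLp_two_noiseLaw_apply (k + 1) σw 0).integrable one_le_two
  have hu1 := hu2.integrable one_le_two
  have hcross := hu1.mul_prod hw
  have hcross0 := integral_prod_mul (μ := ρ) (ν := noiseLaw (k + 1) σw)
    (fun q : Trajectory (k + 1) 1 t × (Fin 1 → ℝ) => q.2 0) (fun w : Fin (k + 1) → ℝ => w 0)
  rw [integral_noiseLaw_apply, mul_zero] at hcross0
  have hbase : Integrable (fun q : Trajectory (k + 1) 1 t × (Fin 1 → ℝ) =>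
      L q.1 - m ^ 2 / (2 * σw ^ 2) * q.2 0 ^ 2) ρ := hLρ.sub (hsq.const_mul _)
  have hF : ∀ q : (Trajectory (k + 1) 1 t × (Fin 1 → ℝ)) × (Fin (k + 1) → ℝ),
      L (Trajectory.init (S.step t q)) + logRatioStep σw m ((S.step t q).1 (Fin.last t) 0)
        (S.lastNoise (S.step t q)) = (L q.1.1 - m ^ 2 / (2 * σw ^ 2) * q.1.2 0 ^ 2) +
          m / σw ^ 2 * (q.1.2 0 * q.2 0) := by
    intro q
    rw [Trajectory.init_step, LTISystem.lastNoise_step]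
    simp only [LTISystem.step, Fin.snoc_last, logRatioStep]
    ring
  have hFm : Measurable fun h : Trajectory (k + 1) 1 (t + 1) => L (Trajectory.init h) +
        logRatioStep σw m (h.1 (Fin.last t) 0) (S.lastNoise h) := by
    have hinit : Measurable (Trajectory.init : Trajectory (k + 1) 1 (t + 1) → _) :=
      Trajectory.measurable_init
    have hnoise := S.measurable_lastNoise (t := t)
    unfold logRatioStep; fun_prop
  have hstep := S.measurable_step t
  have hb := hbase.comp_fst (noiseLaw (k + 1) σw)
  have hc := hcross.const_mul (m / σw ^ 2)
  constructor
  · rw [lawUpTo, integrable_map_measure hFm.aestronglyMeasurable hstep.aemeasurable]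
    refine (hb.add hc).congr (Filter.Eventually.of_forall fun q => (hF q).symm)
  · rw [lawUpTo, integral_map hstep.aemeasurable hFm.aestronglyMeasurable]
    simp_rw [hF]
    rw [integral_add hb hc, integral_const_mul, hcross0, mul_zero, add_zero,
      integral_fun_fst (f := fun q : Trajectory (k + 1) 1 t × (Fin 1 → ℝ) =>
        L q.1 - m ^ 2 / (2 * σw ^ 2) * q.2 0 ^ 2), probReal_univ, one_smul,
      integral_sub hLρ (hsq.const_mul _), hLint, integral_const_mul]
    have : m ^ 2 / (2 * σw ^ 2) * ∫ q, q.2 0 ^ 2 ∂ρ ≤ m ^ 2 / (2 * σw ^ 2) * σu ^ 2 :=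
      mul_le_mul_of_nonneg_left hsqle (by positivity)
    have e : m ^ 2 * σu ^ 2 / (2 * σw ^ 2) = m ^ 2 / (2 * σw ^ 2) * σu ^ 2 := by ring
    rw [e]
    linarith

/-- The law of the perturbed system has a density `exp L` with respect to the law of the original
system, and the relative entropy `-∫ L` grows at most linearly in time. -/
lemma exists_logLikelihoodRatio (hσw : 0 < σw) (S : LTISystem (k + 1) 1) (m : ℝ)
    (π : StabilizationAlgorithm (k + 1) 1 N) {σu : ℝ}
    (hu : ∀ t : Fin N, ∫⁻ q, ‖q.2 0‖ₑ ^ 2 ∂(lawUpTo σw S π t t.2.le ⊗ₘ π.explore t)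
      ≤ ENNReal.ofReal (σu ^ 2)) :
    ∀ (t : ℕ) (ht : t ≤ N), ∃ L : Trajectory (k + 1) 1 t → ℝ, Measurable L ∧
      lawUpTo σw (S.perturb m) π t ht =
        (lawUpTo σw S π t ht).withDensity (fun h => ENNReal.ofReal (Real.exp (L h))) ∧
      Integrable L (lawUpTo σw S π t ht) ∧
      -(t * (m ^ 2 * σu ^ 2 / (2 * σw ^ 2))) ≤ ∫ h, L h ∂lawUpTo σw S π t ht
  | 0, _ => ⟨fun _ => 0, measurable_const, by simp [lawUpTo], integrable_const _, by simp⟩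
  | t + 1, ht => by
    obtain ⟨L, hLm, hd, hLi, hle⟩ :=
      exists_logLikelihoodRatio hσw S m π hu t (Nat.le_of_succ_le ht)
    obtain ⟨h1, h2⟩ := integral_logRatio_succ S m π ht hLm hLi (hu ⟨t, ht⟩)
    have hinit : Measurable (Trajectory.init : Trajectory (k + 1) 1 (t + 1) → _) :=
      Trajectory.measurable_init
    have hnoise := S.measurable_lastNoise (t := t)
    refine ⟨_, ?_, lawUpTo_perturb_succ_eq_withDensity hσw S m π ht hLm hd, h1, ?_⟩
    · unfold logRatioStep; fun_prop
    · push_cast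
      linarith

end LikelihoodRatio

/-! ### The sample complexity bound -/

theorem theorem1 (n : ℕ) (hn : 2 ≤ n) (r v : ℝ) (hr : 1 < r) (hv : 0 < v) (hvr : v < (r - 1) / 2)
    (σw σu : ℝ) (hσw : 0 < σw) (hσu : 0 < σu)
    (C : (k : ℕ) → Set (LTISystem k 1)) (M : ℝ) (hM : 0 < M) (hC : SystemClassBoundedBy C M)
    (hS₁ : hardSystem n r v 0 ∈ C n)
    (hS₂ : hardSystem n r v (2 * (2 * v / (r - 1)) ^ n) ∈ C n)
    (N : ℕ) (π : StabilizationAlgorithm n 1 N) (hπ : π.InputBoundedOn σw σu (C n))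
    (δ : ℝ) (hδ₀ : 0 < δ) (hδ₁ : δ < 1 / 2)
    (hstab : ENNReal.ofReal (1 - δ) ≤
      ⨅ S ∈ C n, trajectoryLaw σw S π {h | S.IsStabilizedBy (π.gain h)}) :
    σw ^ 2 / (2 * σu ^ 2) * ((r - 1) / (2 * v)) ^ (2 * n) * Real.log (1 / (3 * δ)) ≤ N := by
  -- Makes the first and last coordinates visibly distinct.
  obtain ⟨k, rfl⟩ : ∃ k, n = k + 2 := ⟨n - 2, by omega⟩
  set m : ℝ := 2 * (2 * v / (r - 1)) ^ (k + 2) with hm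
  have hperturb : (hardSystem (k + 2) r v 0).perturb m = hardSystem (k + 2) r v m := by
    simp only [LTISystem.perturb, hardSystem, LTISystem.mk.injEq, true_and]
    ext i j
    by_cases hi : i = 0 <;> simp [hi]
  have hs₁ := hstab.trans (iInf₂_le _ hS₁)
  have hs₂ := hstab.trans (iInf₂_le _ hS₂)
  have hu : ∀ t : Fin N, ∫⁻ q, ‖q.2 0‖ₑ ^ 2
      ∂(lawUpTo σw (hardSystem (k + 2) r v 0) π t t.2.le ⊗ₘ π.explore t)
        ≤ ENNReal.ofReal (σu ^ 2) := by
    intro t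
    have h := hπ _ hS₁ t
    have hnorm : ∀ u : Fin 1 → ℝ, ‖WithLp.toLp 2 u‖ₑ = ‖u 0‖ₑ := fun u => by
      rw [← ofReal_norm, ← ofReal_norm, EuclideanSpace.norm_eq]
      simp [Real.sqrt_sq_eq_abs]
    simp_rw [hnorm] at h
    -- The energy constraint is stated under the full trajectory law, whereas the likelihood
    -- recursion needs it under the law up to time `t`.
    have hl := lintegral_input_lawUpTo (σw := σw) (hardSystem (k + 2) r v 0) π
      (g := fun u => ‖u 0‖ₑ ^ 2) (by fun_prop) N t.2 le_rfl
    exact hl ▸ h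
  obtain ⟨L, hLm, hd, hLi, hle⟩ :=
    exists_logLikelihoodRatio hσw (hardSystem (k + 2) r v 0) m π hu N le_rfl
  rw [hperturb] at hd
  let last : Fin (k + 2) := Fin.last (k + 1)
  -- A test event that is visibly measurable, being given by inequalities in entries of the gain: it
  -- contains every success on the first system and excludes every success on the second.
  let E : Set (Trajectory (k + 2) 1 N) := {h | (r - 1) ^ (k + 2) ≤ |π.gain h 0 0| * v ^ (k + 2) ∧
    |r + v * π.gain h 0 last| ≤ ((k + 2 : ℕ) : ℝ)}
  have hg₀ := π.measurable_gain 0 0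
  have hg₁ := π.measurable_gain 0 last
  have hE : MeasurableSet E :=
    MeasurableSet.inter
      (measurableSet_le (g := fun h => |π.gain h 0 0| * v ^ (k + 2)) measurable_const (by fun_prop))
      (measurableSet_le (f := fun h => |r + v * π.gain h 0 last|) (by fun_prop) measurable_const)
  have hE₁ : {h | (hardSystem (k + 2) r v 0).IsStabilizedBy (π.gain h)} ⊆ E := by
    intro h hh
    refine ⟨?_, ?_⟩
    · have := LTISystem.IsStabilizedBy.pow_le_abs_eval_charpoly hh hr
      rwa [hardSystem_zero_eval_charpoly, abs_neg, abs_mul, abs_of_pos (pow_pos hv _)] at this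
    · have := LTISystem.IsStabilizedBy.abs_trace_le hh
      rwa [hardSystem_trace, zero_mul, add_zero] at this
  have hE₂ : {h | (hardSystem (k + 2) r v m).IsStabilizedBy (π.gain h)} ⊆ Eᶜ := by
    intro h hh hhE
    have := LTISystem.IsStabilizedBy.abs_trace_le hh
    rw [hardSystem_trace] at this
    exact hardSystem_gain_incompatible hr hv hhE.1 hhE.2 this
  have hμE : 1 - δ ≤ (lawUpTo σw (hardSystem (k + 2) r v 0) π N le_rfl).real E :=
    (ENNReal.ofReal_le_iff_le_toReal (measure_ne_top _ _)).1 (hs₁.trans (measure_mono hE₁))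
  have hνE : (lawUpTo σw (hardSystem (k + 2) r v m) π N le_rfl).real E ≤ δ := by
    have h1 : 1 - δ ≤ (lawUpTo σw (hardSystem (k + 2) r v m) π N le_rfl).real Eᶜ :=
      (ENNReal.ofReal_le_iff_le_toReal (measure_ne_top _ _)).1 (hs₂.trans (measure_mono hE₂))
    rw [probReal_compl_eq_one_sub hE] at h1
    linarith
  have hkl := (log_inv_three_mul_le hδ₀ hδ₁).trans
    (binary_relative_entropy_le hLi hd hE hδ₀ hδ₁ hμE hνE)
  have hlog : Real.log (1 / (3 * δ)) ≤ N * (m ^ 2 * σu ^ 2 / (2 * σw ^ 2)) := by linarith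
  have hr0 : 0 < r - 1 := by linarith
  calc _ ≤ σw ^ 2 / (2 * σu ^ 2) * ((r - 1) / (2 * v)) ^ (2 * (k + 2)) *
        (N * (m ^ 2 * σu ^ 2 / (2 * σw ^ 2))) := mul_le_mul_of_nonneg_left hlog (by positivity)
    -- The leading factor `2` of `m`, squared, cancels the two halves.
    _ = N * (((r - 1) / (2 * v)) * (2 * v / (r - 1))) ^ (2 * (k + 2)) := by
        rw [hm, mul_pow 2, ← pow_mul, mul_comm (k + 2) 2, mul_pow ((r - 1) / (2 * v))]
        field_simp
    _ = N := by
        rw [div_mul_div_cancel₀ (by positivity), div_self hr0.ne', one_pow, mul_one]
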